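/- Let $n, r, s, t, \Delta$ be non-negative integers with $s \ge 1$, and let $A^{(1)},\dots,A^{(n)} \in \mathbb{Z}^{r\times s}$ and $B^{(1)},\dots,B^{(n)} \in \mathbb{Z}^{r\times t}$ be integer matrices all of whose entries are bounded by $\Delta$ in absolute value. Consider the $2$-stage stochastic constraint matrix $$\mathcal{A} = \begin{pmatrix} A^{(1)} & B^{(1)} & 0 & \cdots & 0\\ A^{(2)} & 0 & B^{(2)} & \ddots & \vdots\\ \vdots & \vdots & \ddots & \ddots & 0\\ A^{(n)} & 0 & \cdots & 0 & B^{(n)} \end{pmatrix} \in \mathbb{Z}^{nr \times (s+nt)}.$$ A vector $y \in \mathbb{Z}^{s+nt}$ with $\mathcal{A}y = 0$ is a Graver element of $\mathcal{A}$ if it cannot be written as $y = u + v$ with nonzero integer vectors $u, v$ satisfying $\mathcal{A}u = \mathcal{A}v = 0$ and $u_j v_j \ge 0$ for every coordinate $j$. Write $y = (y^{(0)}, y^{(1)}, \dots, y^{(n)})$, where $y^{(0)} \in \mathbb{Z}^s$ consists of the entries belonging to the vertical blocks $A^{(i)}$ and $y^{(i)} \in \mathbb{Z}^t$, for $1 \le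 i \le n$, of the entries belonging to the diagonal block $B^{(i)}$. Theorem. There is an absolute constant $C$ (independent of $n, r, s, t, \Delta$ and of the matrices) such that every Graver element $y$ of $\mathcal{A}$ satisfies $$\|y^{(i)}\|_1 \le \max\{2, rs\Delta\}^{\,C\, r s\, (2r\Delta+1)^{r s^2}} \quad \text{for every } 0 \le i \le n,$$ and consequently $\|y\|_\infty$ is bounded by the same quantity. In other words, for $rs\Delta \ge 2$ these norms are at most $(rs\Delta)^{O(rs(2r\Delta+1)^{rs^2})}$, a bound that does not depend on $n$ or $t$. -/

import Mathlib

/-- The `2`-stage stochastic constraint matrix with vertical blocks `A i` and diagonal blocks `B i`.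
Rows are indexed by (block, row in the block); the columns are the `s` columns shared by all blocks,
followed by, for every block, its own `t` columns. -/
def twoStageMatrix {n r s t : ℕ} (A : Fin n → Matrix (Fin r) (Fin s) ℤ)
    (B : Fin n → Matrix (Fin r) (Fin t) ℤ) :
    Matrix (Fin n × Fin r) (Fin s ⊕ Fin n × Fin t) ℤ :=
  Matrix.of fun p => Sum.elim (fun j => A p.1 p.2 j)
    (fun q => if p.1 = q.1 then B p.1 p.2 q.2 else 0)

/-- `y` is a Graver element (an indecomposable integer cycle) of the integer matrix `M`: it lies in
the kernel and is not the sum of two nonzero sign-compatible integer vectors of the kernel. -/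
def IsGraverElement {m k : Type*} [Fintype k] (M : Matrix m k ℤ) (y : k → ℤ) : Prop :=
  M.mulVec y = 0 ∧
    ¬ ∃ u v : k → ℤ, M.mulVec u = 0 ∧ M.mulVec v = 0 ∧ u ≠ 0 ∧ v ≠ 0 ∧
      y = u + v ∧ ∀ j, 0 ≤ u j * v j

/-- The `1`-norm of an integer vector. -/
def oneNorm {k : Type*} [Fintype k] (x : k → ℤ) : ℕ := ∑ j, (x j).natAbs

/-- The entries `y^(0)` of `y` that belong to the vertical blocks. -/
def verticalPart {n s t : ℕ} (y : Fin s ⊕ Fin n × Fin t → ℤ) : Fin s → ℤ :=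
  fun j => y (Sum.inl j)

/-- The entries `y^(i)` of `y` that belong to the `i`-th diagonal block. -/
def diagonalPart {n s t : ℕ} (y : Fin s ⊕ Fin n × Fin t → ℤ) (i : Fin n) : Fin t → ℤ :=
  fun j => y (Sum.inr (i, j))

/-- The bound `max(2, r s Δ) ^ (C · r s (2 r Δ + 1)^(r s²))`. -/
def twoStageBound (C r s Δ : ℕ) : ℕ :=
  max 2 (r * s * Δ) ^ (C * (r * s * (2 * r * Δ + 1) ^ (r * s ^ 2)))

/-! Flipping column signs turns a Graver element into a natural vector `y` that is minimal in the
kernel. For each block `i`, the vector `(y⁰, yⁱ)` lies in the kernel of `(Aⁱ Bⁱ)`. By the Steinitz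
lemma it is a sum of kernel vectors of `1`-norm at most `D = (2rΔ+1)^r`: otherwise two prefix sums
of a well-ordered list of columns coincide.

If a summand vanishes on the shared columns, it alone is a kernel vector, so it equals `y`.
Otherwise every block writes `b = y⁰` as a sum of short nonzero vectors from one set `P` with `|P| ≤
D^s`. If all blocks have subsums with a common value `b' ≠ 0`, these assemble to a kernel vector
below `y`, so `b' = y⁰`. It remains to bound `b'` independently of `n`.

For this (`exists_bounded_common_subcombination`), each representation of `b` is replaced by a basic
one, supported on at most `s` elements of `P`. At most `|P|^s` supports occur, and a basic solution
is determined by its support, so one linear system of bounded size covers all blocks. A large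
elementary vector below its solution is `c • g` with `g` integral and bounded by Cramer's rule. If
`c` is large, `g` fits below all the multiplicities and supplies the subsums; if `c` is small, `b`
itself is bounded. -/

/-! ### Elementary vectors of rational subspaces -/

/-- A support-minimal nonzero nonnegative vector of a subspace of `κ → ℚ`. -/
def IsElementary {κ : Type*} (U : Submodule ℚ (κ → ℚ)) (e : κ → ℚ) : Prop :=
  e ∈ U ∧ 0 ≤ e ∧ e ≠ 0 ∧ ∀ u ∈ U, (∀ k, e k = 0 → u k = 0) → ∃ c : ℚ, u = c • e

/-- Moving from `e ≥ 0` against `u` until a coordinate vanishes. -/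
theorem exists_sub_smul_nonneg {κ : Type*} [Fintype κ] {e u : κ → ℚ} (he : 0 ≤ e)
    (hue : ∀ k, e k = 0 → u k = 0) (hu : ∃ k, 0 < u k) :
    ∃ c : ℚ, 0 < c ∧ 0 ≤ e - c • u ∧ ∃ k, e k ≠ 0 ∧ (e - c • u) k = 0 := by
  classical
  obtain ⟨k₀, hk₀⟩ := hu
  obtain ⟨k, hk, hmin⟩ := Finset.exists_min_image (Finset.univ.filter fun k => 0 < u k)
    (fun k => e k / u k) ⟨k₀, by simpa using hk₀⟩
  simp only [Finset.mem_filter, Finset.mem_univ, true_and] at hk hmin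
  have hek : 0 < e k := lt_of_le_of_ne (he k) fun h => hk.ne' (hue k h.symm)
  refine ⟨e k / u k, div_pos hek hk, fun j => ?_, k, hek.ne', ?_⟩
  · simp only [Pi.zero_apply, Pi.sub_apply, Pi.smul_apply, smul_eq_mul, sub_nonneg]
    rcases le_or_gt (u j) 0 with h | h
    · exact (mul_nonpos_of_nonneg_of_nonpos (div_pos hek hk).le h).trans (he j)
    · exact (le_div_iff₀ h).1 (hmin j h)
  · simp [hk.ne']

/-- Descent on the support: if `x` is not elementary, some `u` in `U` supported inside `x` is no
multiple of it, and subtracting `u` (up to sign) until a coordinate vanishes leaves a nonzero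
vector. -/
theorem exists_isElementary {κ : Type*} [Fintype κ] {U : Submodule ℚ (κ → ℚ)} {x : κ → ℚ}
    (hxU : x ∈ U) (hx : 0 ≤ x) (hx0 : x ≠ 0) :
    ∃ e, IsElementary U e ∧ ∀ k, x k = 0 → e k = 0 := by
  classical
  induction hN : (Finset.univ.filter fun k => x k ≠ 0).card using Nat.strong_induction_on
    generalizing x with
  | _ N ih =>
    by_cases hmin : ∀ u ∈ U, (∀ k, x k = 0 → u k = 0) → ∃ c : ℚ, u = c • x
    · exact ⟨x, ⟨hxU, hx, hx0, hmin⟩, fun _ h => h⟩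
    push Not at hmin
    obtain ⟨u, huU, hux, hne⟩ := hmin
    wlog hu : ∃ k, 0 < u k generalizing u
    · refine this (-u) (U.neg_mem huU) (fun k h => by simp [hux k h])
        (fun c h => hne (-c) (by rw [neg_smul, ← h, neg_neg])) ?_
      by_contra hcon
      push Not at hu hcon
      refine hne 0 (funext fun k => le_antisymm (by simpa using hu k) ?_)
      simpa using hcon k
    obtain ⟨c, hc, hnn, k, hk, hk0⟩ := exists_sub_smul_nonneg hx hux hu
    have hsub : ∀ j, x j = 0 → (x - c • u) j = 0 := fun j h => by simp [h, hux j h]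
    have hlt : (Finset.univ.filter fun k => (x - c • u) k ≠ 0).card < N := by
      rw [← hN]
      refine Finset.card_lt_card ⟨fun j => ?_, fun h => ?_⟩
      · simp only [Finset.mem_filter, Finset.mem_univ, true_and]
        exact fun h h' => h (hsub j h')
      · exact (Finset.mem_filter.1 (h (by simpa using hk))).2 hk0
    have hne0 : x - c • u ≠ 0 := fun h => hne c⁻¹ <| by
      rw [sub_eq_zero.1 h, smul_smul, inv_mul_cancel₀ hc.ne', one_smul]
    obtain ⟨e, he, hex⟩ := ih _ hlt (U.sub_mem hxU (U.smul_mem c huU)) hnn hne0 rfl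
    exact ⟨e, he, fun j h => hex j (hsub j h)⟩

theorem IsElementary.smul {κ : Type*} {U : Submodule ℚ (κ → ℚ)} {e : κ → ℚ}
    (he : IsElementary U e) {c : ℚ} (hc : 0 < c) : IsElementary U (c • e) := by
  obtain ⟨h1, h2, h3, h4⟩ := he
  refine ⟨U.smul_mem c h1, smul_nonneg hc.le h2, smul_ne_zero hc.ne' h3, fun u hu huk => ?_⟩
  obtain ⟨a, rfl⟩ := h4 u hu fun k hk => huk k (by simp [hk])
  exact ⟨a / c, by rw [smul_smul, div_mul_cancel₀ _ hc.ne']⟩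

/-- A nonnegative vector of `U` dominates an elementary one that is not small at a given
coordinate. -/
theorem exists_isElementary_le {κ : Type*} [Fintype κ] {U : Submodule ℚ (κ → ℚ)} {x : κ → ℚ}
    (hxU : x ∈ U) (hx : 0 ≤ x) {k₀ : κ} (hk₀ : 0 < x k₀) :
    ∃ e, IsElementary U e ∧ e ≤ x ∧ x k₀ ≤ Fintype.card κ * e k₀ := by
  classical
  suffices H : ∃ e, IsElementary U e ∧ e ≤ x ∧
      x k₀ ≤ (Finset.univ.filter fun k => x k ≠ 0).card * e k₀ by
    obtain ⟨e, he, hex, hk⟩ := H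
    refine ⟨e, he, hex, hk.trans (mul_le_mul_of_nonneg_right ?_ (he.2.1 k₀))⟩
    exact_mod_cast Finset.card_le_univ _
  induction hN : (Finset.univ.filter fun k => x k ≠ 0).card using Nat.strong_induction_on
    generalizing x with
  | _ N ih =>
    have hx0 : x ≠ 0 := fun h => hk₀.ne' (by simp [h])
    obtain ⟨e, he, hex⟩ := exists_isElementary hxU hx hx0
    have hepos : ∃ k, 0 < e k := by
      by_contra hcon
      push Not at hcon
      exact he.2.2.1 (le_antisymm hcon he.2.1)
    obtain ⟨c, hc, hnn, k, hk, hk0⟩ := exists_sub_smul_nonneg hx hex hepos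
    -- Averaging: if `c • e` carries less than a `1/N` share of `x k₀`, the remainder keeps more
    -- than `(N-1)/N` of it on a support of at most `N - 1` coordinates.
    by_cases hbig : x k₀ ≤ N * (c • e) k₀
    · exact ⟨c • e, he.smul hc, sub_nonneg.1 hnn, hbig⟩
    push Not at hbig
    have hN1 : 1 ≤ N := by
      rw [← hN, Nat.one_le_iff_ne_zero, Finset.card_ne_zero]
      exact ⟨k₀, by simpa using hk₀.ne'⟩
    have hN1' : (1 : ℚ) ≤ N := by exact_mod_cast hN1
    have hce : 0 ≤ (c • e) k₀ := smul_nonneg hc.le he.2.1 k₀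
    have hpos : 0 < (x - c • e) k₀ := by
      rw [Pi.sub_apply]
      nlinarith
    have hlt : (Finset.univ.filter fun k => (x - c • e) k ≠ 0).card < N := by
      rw [← hN]
      refine Finset.card_lt_card ⟨fun j => ?_, fun h => ?_⟩
      · simp only [Finset.mem_filter, Finset.mem_univ, true_and]
        exact fun h h' => h (by simp [h', hex j h'])
      · exact (Finset.mem_filter.1 (h (by simpa using hk))).2 hk0
    obtain ⟨e', he', hle, hk'⟩ := ih _ hlt (U.sub_mem hxU (U.smul_mem c he.1)) hnn hpos rfl
    refine ⟨e', he', hle.trans (sub_le_self _ (smul_nonneg hc.le he.2.1)), ?_⟩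
    have h1 : ((Finset.univ.filter fun k => (x - c • e) k ≠ 0).card : ℚ) ≤ N - 1 := by
      rw [le_sub_iff_add_le]
      exact_mod_cast hlt
    have h2 := hk'.trans (mul_le_mul_of_nonneg_right h1 (he'.2.1 k₀))
    rw [Pi.sub_apply] at h2
    nlinarith [he'.2.1 k₀, hle k₀]

/-! ### Determinants and Cramer's rule -/

theorem Matrix.exists_submatrix_det_ne_zero {ρ τ : Type*} [Fintype ρ] [Fintype τ] [DecidableEq τ]
    (N : Matrix ρ τ ℚ) (hN : ∀ v, N.mulVec v = 0 → v = 0) :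
    ∃ f : τ → ρ, Function.Injective f ∧ (N.submatrix f id).det ≠ 0 := by
  classical
  obtain ⟨κ, a, ha, hspan, hli⟩ := exists_linearIndependent' ℚ N.row
  have hrank : N.rank = Fintype.card τ := by
    have hker : LinearMap.ker N.mulVecLin = ⊥ :=
      (Submodule.eq_bot_iff _).2 fun v hv => hN v (by simpa using hv)
    have := N.mulVecLin.finrank_range_add_finrank_ker
    rw [hker, finrank_bot, add_zero, Module.finrank_fintype_fun_eq_card] at this
    exact this
  have : Finite κ := Finite.of_injective a ha
  have : Fintype κ := Fintype.ofFinite κ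
  have hcard : Fintype.card τ = Fintype.card κ := by
    rw [← hrank, N.rank_eq_finrank_span_row, ← hspan, finrank_span_eq_card hli]
  let e : τ ≃ κ := Fintype.equivOfCardEq hcard
  refine ⟨a ∘ e, ha.comp e.injective, ?_⟩
  have h2 : LinearIndependent ℚ (N.submatrix (a ∘ e) id).row := hli.comp e e.injective
  rw [Matrix.linearIndependent_rows_iff_isUnit, Matrix.isUnit_iff_isUnit_det] at h2
  exact h2.ne_zero

/-- Expanding the product gives one term per map `τ → τ`; the Leibniz formula uses only the
permutations. -/
theorem Matrix.abs_det_le_prod_sum_abs {τ : Type*} [Fintype τ] [DecidableEq τ]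
    (M : Matrix τ τ ℤ) : |M.det| ≤ ∏ i, ∑ j, |M i j| := by
  rw [← Matrix.det_transpose, Matrix.det_apply]
  refine (Finset.abs_sum_le_sum_abs _ _).trans ?_
  rw [Finset.prod_univ_sum, Fintype.piFinset_univ]
  have h : ∀ σ : Equiv.Perm τ, |Equiv.Perm.sign σ • ∏ i, M.transpose (σ i) i| = ∏ i, |M i (σ i)| := by
    intro σ
    rw [Units.smul_def, zsmul_eq_mul, abs_mul, Finset.abs_prod]
    rcases Int.units_eq_one_or (Equiv.Perm.sign σ) with h | h <;> simp [h]
  rw [Finset.sum_congr rfl fun σ _ => h σ]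
  rw [← Finset.sum_image (f := fun p : τ → τ => ∏ i, |M i (p i)|)
    (g := fun σ : Equiv.Perm τ => (σ : τ → τ)) (DFunLike.coe_injective.injOn)]
  exact Finset.sum_le_sum_of_subset_of_nonneg (Finset.subset_univ _) fun p _ _ =>
    Finset.prod_nonneg fun i _ => abs_nonneg _

/-- An elementary vector of the kernel of an integer matrix is proportional to a natural vector
whose entries are bounded in terms of the `1`-norms of the rows. -/
theorem IsElementary.exists_natural {ρ κ : Type*} [Fintype ρ] [Fintype κ] {M : Matrix ρ κ ℤ}
    {R : ℕ} (hR : 1 ≤ R) (hM : ∀ i, ∑ j, |M i j| ≤ R) {e : κ → ℚ}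
    (he : IsElementary (LinearMap.ker (M.map (Int.cast : ℤ → ℚ)).mulVecLin) e) :
    ∃ (c : ℚ) (g : κ → ℕ), 0 < c ∧ (∀ k, e k = c * g k) ∧ ∀ k, g k ≤ R ^ Fintype.card ρ := by
  classical
  obtain ⟨heU, hnn, hne, hmin⟩ := he
  obtain ⟨k₀, hk₀⟩ : ∃ k, e k ≠ 0 := Function.ne_iff.1 hne
  have hk₀pos : 0 < e k₀ := lt_of_le_of_ne (hnn k₀) hk₀.symm
  let τ := {k : κ // k ≠ k₀ ∧ e k ≠ 0}
  have hτ : ∀ (α : Type) [AddCommMonoid α] (F : κ → α), ∑ j : τ, F j =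
      ∑ j ∈ Finset.univ.filter fun k => k ≠ k₀ ∧ e k ≠ 0, F j := fun α _ F =>
    (Finset.sum_subtype _ (by simp) F).symm
  have hsum : ∀ (u : κ → ℚ), (∀ k, e k = 0 → u k = 0) → ∀ i,
      (∑ j, (M i j : ℚ) * u j) = M i k₀ * u k₀ + ∑ j : τ, (M i j : ℚ) * u j := by
    intro u hu i
    rw [← Finset.add_sum_erase _ _ (Finset.mem_univ k₀)]
    congr 1
    rw [hτ ℚ fun j => (M i j : ℚ) * u j]
    refine (Finset.sum_subset (fun k hk => ?_) fun k hk hk' => ?_).symm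
    · simpa using (Finset.mem_filter.1 hk).2.1
    · have : e k = 0 := by
        by_contra h
        exact hk' (by simpa [h] using hk)
      rw [hu k this, mul_zero]
  -- The support columns other than `k₀` are independent: a relation among them is a multiple of `e`
  -- that vanishes at `k₀`.
  obtain ⟨f, hf, hdet⟩ := Matrix.exists_submatrix_det_ne_zero
    (Matrix.of fun (i : ρ) (j : τ) => (M i j : ℚ)) (by
      intro v hv
      let u : κ → ℚ := fun k => if h : k ≠ k₀ ∧ e k ≠ 0 then v ⟨k, h⟩ else 0
      have huv : ∀ j : τ, u j = v j := fun j => dif_pos j.2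
      have hu0 : u k₀ = 0 := dif_neg (by simp)
      have hue : ∀ k, e k = 0 → u k = 0 := fun k hk => dif_neg (by simp [hk])
      obtain ⟨c, hc⟩ := hmin u (by
        rw [LinearMap.mem_ker]
        ext i
        have h1 := congrFun hv i
        simp only [Matrix.mulVec, dotProduct, Matrix.of_apply, Pi.zero_apply] at h1
        simp only [Matrix.mulVecLin_apply, Matrix.mulVec, dotProduct, Matrix.map_apply,
          Pi.zero_apply]
        rw [hsum u hue, hu0, mul_zero, zero_add]
        simpa [huv] using h1) hue
      have hc0 : c = 0 := by
        have := congrFun hc k₀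
        simpa [hu0, hk₀] using this.symm
      ext j
      rw [← huv, hc, hc0]
      simp)
  let M' : Matrix τ τ ℤ := Matrix.of fun i j => M (f i) j
  let w : τ → ℤ := fun i => -M (f i) k₀
  have hM' : M'.map (Int.cast : ℤ → ℚ) =
      (Matrix.of fun (i : ρ) (j : τ) => (M i j : ℚ)).submatrix f id := rfl
  rw [← hM'] at hdet
  have hdetZ : ((M'.det : ℤ) : ℚ) ≠ 0 := by
    rwa [Int.cast_det]
  have hMe : (M'.map (Int.cast : ℤ → ℚ)).mulVec (fun j : τ => e j) = e k₀ • fun i => (w i : ℚ) := by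
    ext i
    have h1 := congrFun (LinearMap.mem_ker.1 heU) (f i)
    simp only [Matrix.mulVecLin_apply, Matrix.mulVec, dotProduct, Matrix.map_apply,
      Pi.zero_apply] at h1
    rw [hsum e fun _ h => h] at h1
    simp only [Matrix.mulVec, dotProduct, Matrix.map_apply, Pi.smul_apply, smul_eq_mul, M', w,
      Matrix.of_apply]
    push_cast
    linarith
  have hcram : ∀ j : τ, (M'.det : ℚ) * e j = e k₀ * (M'.cramer w j : ℤ) := by
    intro j
    have h1 := congrArg (fun v => (M'.map (Int.cast : ℤ → ℚ)).adjugate.mulVec v j) hMe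
    simp only [Matrix.mulVec_mulVec, Matrix.adjugate_mul, Matrix.mulVec_smul,
      ← Matrix.cramer_eq_adjugate_mulVec, Matrix.smul_mulVec, Matrix.one_mulVec, Pi.smul_apply,
      smul_eq_mul] at h1
    rw [Int.cast_det, h1, Matrix.cramer_apply, Matrix.cramer_apply, Int.cast_det,
      Matrix.map_updateCol]
    rfl
  -- Column `k₀` is included so that the Cramer numerators, where it replaces another column, obey
  -- the same row bound.
  have hrow : ∀ i, (∑ j : τ, |M i j|) + |M i k₀| ≤ R := by
    intro i
    refine le_trans ?_ (hM i)
    rw [hτ ℤ fun j => |M i j|, ← Finset.add_sum_erase _ _ (Finset.mem_univ k₀), add_comm]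
    refine (add_le_add_iff_left _).2 (Finset.sum_le_sum_of_subset_of_nonneg (fun k hk => ?_)
      fun _ _ _ => abs_nonneg _)
    simpa using (Finset.mem_filter.1 hk).2.1
  have hcardle : Fintype.card τ ≤ Fintype.card ρ := Fintype.card_le_of_injective f hf
  have hbound : ∀ N : Matrix τ τ ℤ, (∀ i, ∑ j, |N i j| ≤ R) → N.det.natAbs ≤ R ^ Fintype.card ρ := by
    intro N hN
    have h1 : |N.det| ≤ (R : ℤ) ^ Fintype.card τ := N.abs_det_le_prod_sum_abs.trans <| by
      rw [← Finset.card_univ, ← Finset.prod_const]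
      exact Finset.prod_le_prod (fun i _ => Finset.sum_nonneg fun _ _ => abs_nonneg _)
        fun i _ => hN i
    have h2 : N.det.natAbs ≤ R ^ Fintype.card τ := by
      zify
      exact h1
    exact h2.trans (Nat.pow_le_pow_right hR hcardle)
  have hdetle : M'.det.natAbs ≤ R ^ Fintype.card ρ :=
    hbound _ fun i => (le_add_of_nonneg_right (abs_nonneg _)).trans (hrow (f i))
  have hcramle : ∀ j, (M'.cramer w j).natAbs ≤ R ^ Fintype.card ρ := by
    intro j
    rw [Matrix.cramer_apply]
    refine hbound _ fun i => le_trans ?_ (hrow (f i))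
    rw [← Finset.add_sum_erase _ _ (Finset.mem_univ j), Matrix.updateCol_self, add_comm]
    refine add_le_add ?_ (by simp [w])
    rw [Finset.sum_congr rfl (g := fun l : τ => |M (f i) l|) fun l hl => by
      rw [Matrix.updateCol_ne (Finset.ne_of_mem_erase hl)]; rfl]
    exact Finset.sum_le_sum_of_subset_of_nonneg (Finset.erase_subset _ _)
      fun _ _ _ => abs_nonneg _
  have hdpos : (0 : ℚ) < (M'.det.natAbs : ℚ) := by
    rw [Nat.cast_natAbs, Int.cast_abs]
    exact abs_pos.2 hdetZ
  refine ⟨e k₀ / M'.det.natAbs, fun k => if h : k ≠ k₀ ∧ e k ≠ 0 then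
    (M'.cramer w ⟨k, h⟩).natAbs else if k = k₀ then M'.det.natAbs else 0,
    div_pos hk₀pos hdpos, fun k => ?_, fun k => ?_⟩
  · by_cases h : k ≠ k₀ ∧ e k ≠ 0
    · simp only [dif_pos h]
      rw [div_mul_eq_mul_div, eq_div_iff hdpos.ne', mul_comm]
      have h1 := congrArg abs (hcram ⟨k, h⟩)
      rw [abs_mul, abs_mul, abs_of_nonneg (hnn k), abs_of_nonneg (hnn k₀)] at h1
      simpa [Nat.cast_natAbs] using h1
    · simp only [dif_neg h]
      by_cases hk : k = k₀
      · rw [if_pos hk, div_mul_cancel₀ _ hdpos.ne', hk]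
      · have : e k = 0 := by
          by_contra h'
          exact h ⟨hk, h'⟩
        simp [hk, this]
  · by_cases h : k ≠ k₀ ∧ e k ≠ 0
    · simpa only [dif_pos h] using hcramle _
    · simp only [dif_neg h]
      split_ifs
      exacts [hdetle, Nat.zero_le _]
-- The Steinitz lemma
theorem exists_relation_of_card_lt {ι τ : Type*} [Fintype ι] [Fintype τ] (F : Finset ι)
    (w : ι → τ → ℚ) (h : Fintype.card τ < F.card) :
    ∃ ν : ι → ℚ, ν ≠ 0 ∧ (∀ i ∉ F, ν i = 0) ∧ ∀ a, ∑ i, ν i * w i a = 0 := by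
  classical
  have hker : LinearMap.ker (Fintype.linearCombination ℚ fun i : F => w i) ≠ ⊥ := by
    apply LinearMap.ker_ne_bot_of_finrank_lt
    simpa using h
  obtain ⟨μ, hμ, hμ0⟩ := (Submodule.ne_bot_iff _).1 hker
  rw [LinearMap.mem_ker, Fintype.linearCombination_apply] at hμ
  refine ⟨fun i => if hi : i ∈ F then μ ⟨i, hi⟩ else 0, fun h0 => hμ0 (funext fun i => ?_),
    fun i hi => dif_neg hi, fun a => ?_⟩
  · have := congrFun h0 i
    simpa using this
  · have h1 := congrFun hμ a
    rw [Finset.sum_apply] at h1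
    rw [← Finset.sum_subset (Finset.subset_univ F) fun i _ hi => by simp [hi],
      ← Finset.sum_coe_sort]
    simpa using h1

/-- The weights in the proof of the Steinitz lemma. -/
def HasSteinitzWeights {ι : Type*} [Fintype ι] {r : ℕ} (x : ι → Fin r → ℤ) (A : Finset ι) : Prop :=
  ∃ l : ι → ℚ, (∀ i, 0 ≤ l i) ∧ (∀ i, l i ≤ 1) ∧ (∀ i ∉ A, l i = 0) ∧
    ∑ i, l i = A.card - r ∧ ∀ a, ∑ i, l i * x i a = 0

/-- The cone over the weights on `A` of total mass `m`, with slack variables. -/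
def steinitzCone {ι : Type*} [Fintype ι] {r : ℕ} (x : ι → Fin r → ℤ) (A : Finset ι) (m : ℚ) :
    Submodule ℚ (ι ⊕ ι ⊕ Unit → ℚ) where
  carrier := {v | (∀ i ∈ A, v (.inl i) + v (.inr (.inl i)) = v (.inr (.inr ()))) ∧
    (∀ i ∉ A, v (.inl i) = 0 ∧ v (.inr (.inl i)) = 0) ∧
    ∑ i, v (.inl i) = m * v (.inr (.inr ())) ∧ ∀ a, ∑ i, v (.inl i) * x i a = 0}
  zero_mem' := by simp
  add_mem' := by
    rintro v w ⟨h1, h2, h3, h4⟩ ⟨k1, k2, k3, k4⟩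
    refine ⟨fun i hi => ?_, fun i hi => ?_, ?_, fun a => ?_⟩
    · simp only [Pi.add_apply, ← h1 i hi, ← k1 i hi]
      ring
    · simp [h2 i hi, k2 i hi]
    · simp only [Pi.add_apply, Finset.sum_add_distrib, h3, k3]
      ring
    · simp only [Pi.add_apply, add_mul, Finset.sum_add_distrib, h4, k4, add_zero]
  smul_mem' := by
    rintro c v ⟨h1, h2, h3, h4⟩
    refine ⟨fun i hi => ?_, fun i hi => ?_, ?_, fun a => ?_⟩
    · simp only [Pi.smul_apply, ← h1 i hi, smul_eq_mul]
      ring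
    · simp [h2 i hi]
    · simp only [Pi.smul_apply, smul_eq_mul, ← Finset.mul_sum, h3]
      ring
    · simp only [Pi.smul_apply, smul_eq_mul, mul_assoc, ← Finset.mul_sum, h4, mul_zero]

/-- Scaling the weights down to total mass `|A| - 1 - r` keeps them feasible. A vertex of the
feasible polytope, encoded as an elementary vector of the homogenized cone, has at most `r + 1`
weights strictly between `0` and `1`, so that mass forces some weight to be `0`; its index can be
removed. -/
theorem HasSteinitzWeights.exists_erase {ι : Type*} [Fintype ι] [DecidableEq ι] {r : ℕ}
    {x : ι → Fin r → ℤ} {A : Finset ι} (hA : HasSteinitzWeights x A) (hr : r < A.card) :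
    ∃ a ∈ A, HasSteinitzWeights x (A.erase a) := by
  obtain ⟨l, hl0, hl1, hlA, hls, hlx⟩ := hA
  have hr' : (r : ℚ) + 1 ≤ A.card := by exact_mod_cast hr
  have hrpos : (0 : ℚ) < A.card - r := by linarith
  set m : ℚ := A.card - 1 - r with hm
  have hm0 : 0 ≤ m := by linarith
  set q : ℚ := m / (A.card - r) with hq
  have hq0 : 0 ≤ q := div_nonneg hm0 hrpos.le
  have hq1 : q ≤ 1 := (div_le_one hrpos).2 (by linarith)
  let v : ι ⊕ ι ⊕ Unit → ℚ := Sum.elim (fun i => q * l i)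
    (Sum.elim (fun i => if i ∈ A then 1 - q * l i else 0) fun _ => 1)
  have hvU : v ∈ steinitzCone x A m := by
    refine ⟨fun i hi => ?_, fun i hi => ?_, ?_, fun a => ?_⟩
    · simp [v, hi]
    · simp [v, hi, hlA i hi]
    · simp only [v, Sum.elim_inl, Sum.elim_inr, ← Finset.mul_sum, hls, mul_one]
      exact div_mul_cancel₀ _ hrpos.ne'
    · simp only [v, Sum.elim_inl, mul_assoc, ← Finset.mul_sum, hlx, mul_zero]
  have hv0 : 0 ≤ v := by
    rintro (i | i | i)
    · exact mul_nonneg hq0 (hl0 i)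
    · simp only [v, Sum.elim_inl, Sum.elim_inr, Pi.zero_apply]
      split_ifs
      · exact sub_nonneg.2 (mul_le_one₀ hq1 (hl0 i) (hl1 i))
      · exact le_rfl
    · exact zero_le_one
  obtain ⟨e, ⟨⟨h1, h2, h3, h4⟩, hnn, hne, hmin⟩, -⟩ := exists_isElementary hvU hv0
    (fun h => one_ne_zero (congrFun h (.inr (.inr ()))))
  set c := e (.inr (.inr ())) with hc
  have hcpos : 0 < c := by
    refine lt_of_le_of_ne (hnn _) fun hc0 => hne (funext fun k => ?_)
    have hz : ∀ i, e (.inl i) = 0 ∧ e (.inr (.inl i)) = 0 := by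
      intro i
      by_cases hi : i ∈ A
      · have h5 := h1 i hi
        rw [← hc0] at h5
        exact (add_eq_zero_iff_of_nonneg (hnn _) (hnn _)).1 h5
      · exact h2 i hi
    rcases k with i | i | i
    exacts [(hz i).1, (hz i).2, hc0.symm]
  let F := A.filter fun i => e (.inl i) ≠ 0 ∧ e (.inr (.inl i)) ≠ 0
  have hF : F.card ≤ r + 1 := by
    by_contra hcon
    push Not at hcon
    -- The coordinate `none` records the total mass; with it the vectors live in dimension `r + 1`.
    obtain ⟨ν, hν0, hνF, hν⟩ := exists_relation_of_card_lt F
      (fun i => fun o : Option (Fin r) => o.elim 1 fun a => (x i a : ℚ)) (by simpa using hcon)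
    have hνA : ∀ i ∉ A, ν i = 0 := fun i hi => hνF i fun h => hi (Finset.mem_filter.1 h).1
    obtain ⟨t, ht⟩ := hmin (Sum.elim ν (Sum.elim (-ν) 0)) (by
        refine ⟨fun i hi => ?_, fun i hi => ?_, ?_, fun a => ?_⟩
        · simp
        · simp [hνA i hi]
        · simpa using hν none
        · simpa using hν (some a)) (by
        rintro (i | i | i) hi
        · exact hνF i fun h => (Finset.mem_filter.1 h).2.1 hi
        · simp [hνF i fun h => (Finset.mem_filter.1 h).2.2 hi]
        · rfl)
    have ht0 : t = 0 := by
      have := congrFun ht (.inr (.inr ()))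
      simp only [Sum.elim_inr, Pi.zero_apply, Pi.smul_apply, smul_eq_mul] at this
      exact (mul_eq_zero.1 this.symm).resolve_right hcpos.ne'
    refine hν0 (funext fun i => ?_)
    have := congrFun ht (.inl i)
    simpa [ht0] using this
  -- If no weight vanished, all weights outside `F` would be full, and these alone have mass at
  -- least `|A| - r - 1`.
  obtain ⟨a, haA, ha⟩ : ∃ a ∈ A, e (.inl a) = 0 := by
    by_contra hcon
    push Not at hcon
    have hsum : ∑ i, e (.inl i) = ∑ i ∈ A \ F, c + ∑ i ∈ F, e (.inl i) := by
      rw [← Finset.sum_subset (Finset.subset_univ A) fun i _ hi => (h2 i hi).1,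
        ← Finset.sum_sdiff (Finset.filter_subset _ A : F ⊆ A)]
      congr 1
      refine Finset.sum_congr rfl fun i hi => ?_
      obtain ⟨hiA, hiF⟩ := Finset.mem_sdiff.1 hi
      have h5 : e (.inr (.inl i)) = 0 := by
        by_contra h
        exact hiF (Finset.mem_filter.2 ⟨hiA, hcon i hiA, h⟩)
      rw [← h1 i hiA, h5, add_zero]
    rw [h3, Finset.sum_const, nsmul_eq_mul,
      Finset.cast_card_sdiff (Finset.filter_subset _ A : F ⊆ A)] at hsum
    have hF' : (F.card : ℚ) ≤ r + 1 := by exact_mod_cast hF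
    change _ = (_ - (F.card : ℚ)) * c + _ at hsum
    rcases F.eq_empty_or_nonempty with h | h
    · rw [h, Finset.sum_empty, Finset.card_empty, Nat.cast_zero] at hsum
      nlinarith [(Nat.cast_nonneg r : (0 : ℚ) ≤ r)]
    · have : 0 < ∑ i ∈ F, e (.inl i) := Finset.sum_pos (fun i hi =>
        lt_of_le_of_ne (hnn _) (Finset.mem_filter.1 hi).2.1.symm) h
      nlinarith
  refine ⟨a, haA, fun i => e (.inl i) / c, fun i => div_nonneg (hnn _) hcpos.le, fun i => ?_,
    fun i hi => ?_, ?_, fun b => ?_⟩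
  · rw [div_le_one hcpos]
    by_cases hi : i ∈ A
    · rw [← h1 i hi]
      exact le_add_of_nonneg_right (hnn _)
    · rw [(h2 i hi).1]
      exact hcpos.le
  · rw [Finset.mem_erase, not_and_or, not_not] at hi
    rcases hi with rfl | hi
    · simp [ha]
    · simp [(h2 i hi).1]
  · rw [← Finset.sum_div, h3, mul_div_cancel_right₀ _ hcpos.ne', Finset.card_erase_of_mem haA,
      Nat.cast_sub (Nat.one_le_of_lt hr)]
    simp [hm]
  · simp only [div_mul_eq_mul_div, ← Finset.sum_div, h4, zero_div]

/-- The Steinitz lemma, for a set carrying weights. -/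
theorem HasSteinitzWeights.exists_chain {ι : Type*} [Fintype ι] {r Δ : ℕ} {x : ι → Fin r → ℤ}
    (hx : ∀ i a, |x i a| ≤ (Δ : ℤ)) (A : Finset ι) (hA : A.card ≤ r ∨ HasSteinitzWeights x A) :
    ∃ c : ℕ → Finset ι, Monotone c ∧ (∀ k, c k ⊆ A) ∧ (∀ k ≤ A.card, (c k).card = k) ∧
      ∀ k a, |∑ i ∈ c k, x i a| ≤ (r * Δ : ℤ) := by
  classical
  induction hN : A.card generalizing A with
  | zero =>
    refine ⟨fun _ => ∅, monotone_const, fun _ => Finset.empty_subset _, fun k hk => ?_,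
      fun k a => ?_⟩
    · rw [Finset.card_empty, Nat.le_zero.1 hk]
    · simp only [Finset.sum_empty, abs_zero]
      positivity
  | succ N ih =>
    have hstep : ∃ a ∈ A, (A.erase a).card ≤ r ∨ HasSteinitzWeights x (A.erase a) := by
      by_cases h : A.card ≤ r
      · obtain ⟨a, ha⟩ := Finset.card_pos.1 (hN.symm ▸ N.succ_pos : 0 < A.card)
        exact ⟨a, ha, .inl (Finset.card_erase_le.trans h)⟩
      · obtain ⟨a, ha, h'⟩ := (hA.resolve_left h).exists_erase (not_le.1 h)
        exact ⟨a, ha, .inr h'⟩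
    obtain ⟨a, ha, hA'⟩ := hstep
    have hcard : (A.erase a).card = N := by rw [Finset.card_erase_of_mem ha, hN]; rfl
    obtain ⟨c, hmono, hsub, hc, hb⟩ := ih _ hA' hcard
    have hAb : ∀ b, |∑ i ∈ A, x i b| ≤ (r * Δ : ℤ) := by
      intro b
      rcases hA with h | ⟨l, hl0, hl1, hlA, hls, hlx⟩
      · calc |∑ i ∈ A, x i b| ≤ ∑ i ∈ A, (Δ : ℤ) :=
            (Finset.abs_sum_le_sum_abs _ _).trans (Finset.sum_le_sum fun i _ => hx i b)
          _ ≤ r * Δ := by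
            rw [Finset.sum_const, nsmul_eq_mul]
            exact mul_le_mul_of_nonneg_right (by exact_mod_cast h) (by positivity)
      -- Since the weighted sum is zero, the weights may be replaced by `1 - l`, whose total mass on
      -- `A` is only `r`.
      · have h1 : ((∑ i ∈ A, x i b : ℤ) : ℚ) = ∑ i ∈ A, (1 - l i) * x i b := by
          simp only [sub_mul, one_mul, Finset.sum_sub_distrib]
          rw [Finset.sum_subset (Finset.subset_univ A) (f := fun i => l i * (x i b : ℚ))
            fun i _ hi => by simp [hlA i hi], hlx b]
          simp
        have h2 : |∑ i ∈ A, (1 - l i) * (x i b : ℚ)| ≤ r * Δ := by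
          calc |∑ i ∈ A, (1 - l i) * (x i b : ℚ)| ≤ ∑ i ∈ A, (1 - l i) * Δ := by
                refine (Finset.abs_sum_le_sum_abs _ _).trans (Finset.sum_le_sum fun i _ => ?_)
                rw [abs_mul, abs_of_nonneg (sub_nonneg.2 (hl1 i))]
                refine mul_le_mul_of_nonneg_left ?_ (sub_nonneg.2 (hl1 i))
                exact_mod_cast hx i b
            _ = r * Δ := by
                rw [← Finset.sum_mul, Finset.sum_sub_distrib,
                  Finset.sum_subset (Finset.subset_univ A) (f := l) fun i _ hi => hlA i hi, hls]
                simp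
        rw [← h1] at h2
        exact_mod_cast h2
    refine ⟨fun k => if k ≤ N then c k else A, fun j k hjk => ?_, fun k => ?_, fun k hk => ?_,
      fun k b => ?_⟩
    · dsimp only
      split_ifs with h1 h2 h2
      · exact hmono hjk
      · exact (hsub j).trans (Finset.erase_subset _ _)
      · exact absurd (hjk.trans h2) h1
      · exact le_rfl
    · dsimp only
      split_ifs
      exacts [(hsub k).trans (Finset.erase_subset _ _), le_rfl]
    · dsimp only
      split_ifs with h1
      · exact hc k h1
      · omega
    · dsimp only
      split_ifs
      exacts [hb k b, hAb b]

/-- A long zero-sum family of bounded integer vectors has a proper zero-sum subfamily. -/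
theorem exists_proper_zero_sum {ι : Type*} [Fintype ι] {r Δ : ℕ} {x : ι → Fin r → ℤ}
    (hx : ∀ i a, |x i a| ≤ (Δ : ℤ)) (hsum : ∀ a, ∑ i, x i a = 0)
    (hcard : (2 * r * Δ + 1) ^ r < Fintype.card ι) :
    ∃ S : Finset ι, S.Nonempty ∧ S ≠ Finset.univ ∧ ∀ a, ∑ i ∈ S, x i a = 0 := by
  classical
  have hgood : (Finset.univ : Finset ι).card ≤ r ∨ HasSteinitzWeights x Finset.univ := by
    rw [or_iff_not_imp_left, not_le]
    intro h
    have hpos : (0 : ℚ) < (Finset.univ : Finset ι).card := by exact_mod_cast (Nat.zero_le r).trans_lt h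
    have hle : (r : ℚ) ≤ (Finset.univ : Finset ι).card := by exact_mod_cast h.le
    refine ⟨fun _ => ((Finset.univ : Finset ι).card - r) / (Finset.univ : Finset ι).card,
      fun _ => div_nonneg (sub_nonneg.2 hle) hpos.le, fun _ => (div_le_one hpos).2 ?_,
      fun i hi => absurd (Finset.mem_univ i) hi, ?_, fun a => ?_⟩
    · linarith [(Nat.cast_nonneg r : (0 : ℚ) ≤ r)]
    · rw [Finset.sum_const, nsmul_eq_mul, mul_div_cancel₀ _ hpos.ne']
    · rw [← Finset.mul_sum]
      have : ((∑ i, x i a : ℤ) : ℚ) = 0 := by rw [hsum]; rfl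
      push_cast at this
      rw [this, mul_zero]
  obtain ⟨c, hmono, -, hc, hb⟩ := HasSteinitzWeights.exists_chain hx Finset.univ hgood
  rw [Finset.card_univ] at hc
  -- Pigeonhole over the prefix lengths `0, …, |ι| - 1`; leaving out the full length makes the
  -- difference of two prefixes a proper subset.
  obtain ⟨j, hj, k, hk, hjk, heq⟩ := Finset.exists_ne_map_eq_of_card_lt_of_maps_to
    (s := Finset.range (Fintype.card ι))
    (t := Fintype.piFinset fun _ : Fin r => Finset.Icc (-(r * Δ : ℤ)) (r * Δ))
    (f := fun k a => ∑ i ∈ c k, x i a) (by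
      rw [Fintype.card_piFinset_const, Int.card_Icc, Finset.card_range]
      convert hcard using 2
      rw [show (r * Δ + 1 - -(r * Δ) : ℤ) = (2 * r * Δ + 1 : ℕ) by push_cast; ring,
        Int.toNat_natCast]) (fun k _ => by
      simp only [Finset.mem_coe, Fintype.mem_piFinset, Finset.mem_Icc]
      exact fun a => abs_le.1 (hb k a))
  wlog hlt : j < k generalizing j k
  · exact this k hk j hj hjk.symm heq.symm (lt_of_le_of_ne (not_lt.1 hlt) hjk.symm)
  rw [Finset.mem_range] at hj hk
  have hcs : (c k \ c j).card = k - j := by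
    rw [Finset.card_sdiff_of_subset (hmono hlt.le), hc k hk.le, hc j hj.le]
  refine ⟨c k \ c j, Finset.card_pos.1 (by omega), fun h => ?_, fun a => ?_⟩
  · rw [h, Finset.card_univ] at hcs
    omega
  · have := Finset.sum_sdiff (f := fun i => x i a) (hmono hlt.le)
    have h2 := congrFun heq a
    linarith

/-! ### Decomposition into short kernel vectors -/

/-- Natural kernel vectors of a bounded matrix decompose into short ones. -/
theorem exists_list_kernel_decomposition {κ : Type*} [Fintype κ] {r Δ : ℕ}
    {M : Matrix (Fin r) κ ℤ} (hM : ∀ a k, |M a k| ≤ (Δ : ℤ)) (y : κ → ℕ)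
    (hy : ∀ a, ∑ k, M a k * y k = 0) :
    ∃ l : List (κ → ℕ), l.sum = y ∧ ∀ w ∈ l, w ≠ 0 ∧ (∀ a, ∑ k, M a k * w k = 0) ∧
      ∑ k, w k ≤ (2 * r * Δ + 1) ^ r := by
  classical
  induction hN : ∑ k, y k using Nat.strong_induction_on generalizing y with
  | _ N ih =>
    by_cases hy0 : y = 0
    · exact ⟨[], hy0.symm, by simp⟩
    by_cases hsmall : ∑ k, y k ≤ (2 * r * Δ + 1) ^ r
    · exact ⟨[y], by simp, by simpa using ⟨hy0, hy, hsmall⟩⟩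
    -- The zero-sum family contains column `k` exactly `y k` times.
    obtain ⟨S, hS, hSu, hS0⟩ := exists_proper_zero_sum
      (x := fun (p : Σ k, Fin (y k)) a => M a p.1) (fun p a => hM a p.1) (fun a => by
        rw [Fintype.sum_sigma, ← hy a]
        refine Finset.sum_congr rfl fun k _ => ?_
        simp [mul_comm]) (by simpa using hsmall)
    let u : κ → ℕ := fun k => (S.filter fun p => p.1 = k).card
    have husum : ∑ k, u k = S.card :=
      (Finset.card_eq_sum_card_fiberwise fun _ _ => Finset.mem_coe.2 (Finset.mem_univ _)).symm
    have huy : u ≤ y := by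
      intro k
      calc u k ≤ (Finset.univ.image fun j : Fin (y k) => (⟨k, j⟩ : Σ k, Fin (y k))).card := by
            refine Finset.card_le_card fun p hp => ?_
            obtain ⟨k', j⟩ := p
            obtain rfl : k' = k := (Finset.mem_filter.1 hp).2
            simp
        _ ≤ y k := Finset.card_image_le.trans (by simp)
    have hu0 : ∀ a, ∑ k, M a k * u k = 0 := by
      intro a
      rw [← hS0 a, ← Finset.sum_fiberwise S (fun p => p.1)]
      refine Finset.sum_congr rfl fun k _ => ?_
      rw [Finset.sum_congr rfl fun p hp => by rw [(Finset.mem_filter.1 hp).2], Finset.sum_const,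
        nsmul_eq_mul, mul_comm]
    have hSpos := hS.card_pos
    have hSlt : S.card < ∑ k, y k := by
      have := Finset.card_lt_univ_of_notMem (s := S) (x := ?_) ?_
      · simpa using this
      · exact (not_forall.1 fun h => hSu (Finset.eq_univ_iff_forall.2 h)).choose
      · exact (not_forall.1 fun h => hSu (Finset.eq_univ_iff_forall.2 h)).choose_spec
    have hadd : ∑ k, (y - u) k + ∑ k, u k = ∑ k, y k := by
      rw [← Finset.sum_add_distrib]
      exact Finset.sum_congr rfl fun k _ => Nat.sub_add_cancel (huy k)
    obtain ⟨l₁, hl₁, hl₁'⟩ := ih _ (by omega) u hu0 rfl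
    obtain ⟨l₂, hl₂, hl₂'⟩ := ih _ (by omega) (y - u) (fun a => by
      have : ∀ k, M a k * ((y - u) k : ℕ) = M a k * y k - M a k * u k := fun k => by
        rw [Pi.sub_apply, Nat.cast_sub (huy k), mul_sub]
      simp only [this, Finset.sum_sub_distrib, hy, hu0, sub_zero]) rfl
    refine ⟨l₁ ++ l₂, ?_, fun w hw => ?_⟩
    · rw [List.sum_append, hl₁, hl₂]
      exact add_tsub_cancel_of_le huy
    · rcases List.mem_append.1 hw with h | h
      exacts [hl₁' w h, hl₂' w h]

theorem exists_kernel_decomposition {κ : Type*} [Fintype κ] {r Δ : ℕ}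
    {M : Matrix (Fin r) κ ℤ} (hM : ∀ a k, |M a k| ≤ (Δ : ℤ)) (y : κ → ℕ)
    (hy : ∀ a, ∑ k, M a k * y k = 0) :
    ∃ (m : ℕ) (w : Fin m → κ → ℕ), ∑ j, w j = y ∧ ∀ j, w j ≠ 0 ∧
      (∀ a, ∑ k, M a k * w j k = 0) ∧ ∑ k, w j k ≤ (2 * r * Δ + 1) ^ r := by
  obtain ⟨l, hl, hw⟩ := exists_list_kernel_decomposition hM y hy
  refine ⟨l.length, l.get, ?_, fun j => hw _ (l.get_mem j)⟩
  rw [← hl, ← List.sum_ofFn, List.ofFn_get]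

/-! ### Common subcombinations of bounded value -/

/-- Used to count supports: listing elements with repetition gives at most `|P|^d` of them. -/
theorem Finset.exists_fin_image_eq {P : Type*} [DecidableEq P] {d : ℕ} (σ : Finset P)
    (h0 : σ.Nonempty) (hd : σ.card ≤ d) : ∃ f : Fin d → P, Finset.univ.image f = σ := by
  have : Nonempty σ := h0.to_subtype
  obtain ⟨f⟩ : Nonempty (σ ↪ Fin d) := Function.Embedding.nonempty_of_card_le (by simpa using hd)
  have hs := Function.invFun_surjective f.injective
  refine ⟨fun j => (Function.invFun f j : σ), Finset.ext fun p => ?_⟩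
  simp only [Finset.mem_image, Finset.mem_univ, true_and]
  exact ⟨fun ⟨j, hj⟩ => hj ▸ (Function.invFun (f : σ → Fin d) j).2,
    fun hp => (hs ⟨p, hp⟩).imp fun j hj => by rw [hj]⟩

/-- The vectors `(z, c)` with `∑ z p • v p = c • b`. -/
def homogenizedSolutions {P : Type*} [Fintype P] {d : ℕ} (v : P → Fin d → ℕ) (b : Fin d → ℕ) :
    Submodule ℚ (Option P → ℚ) where
  carrier := {u | ∀ a, ∑ p, u (some p) * v p a = u none * b a}
  zero_mem' := by simp
  add_mem' := by
    intro u w hu hw a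
    simp only [Pi.add_apply, add_mul, Finset.sum_add_distrib, hu a, hw a]
  smul_mem' := by
    intro c u hu a
    simp only [Pi.smul_apply, smul_eq_mul, mul_assoc, ← Finset.mul_sum, hu a]

/-- A conic combination dominates, up to a factor, a basic one with the same value. -/
theorem exists_basic_combination {P : Type*} [Fintype P] [DecidableEq P] {d : ℕ}
    {v : P → Fin d → ℕ} {b : Fin d → ℕ} (hb : b ≠ 0) {T : P → ℕ}
    (hT : ∀ a, ∑ p, T p * v p a = b a) :
    ∃ (σ : Finset P) (z : P → ℚ), σ.Nonempty ∧ σ.card ≤ d ∧ (∀ p, 0 ≤ z p) ∧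
      (∀ p ∉ σ, z p = 0) ∧ (∀ a, ∑ p, z p * v p a = b a) ∧
      (∀ p, z p ≤ (Fintype.card P + 1) * T p) ∧
      ∀ z' : P → ℚ, (∀ p ∉ σ, z' p = 0) → (∀ a, ∑ p, z' p * v p a = b a) → z' = z := by
  -- The homogenizing coordinate `none` is `1` in `x` and at least `1/(|P|+1)` in `e`. Normalizing
  -- it back to `1` costs the factor `|P| + 1` in the bound by `T`.
  obtain ⟨e, ⟨heU, hnn, hne, hmin⟩, hle, hbig⟩ := exists_isElementary_le
    (U := homogenizedSolutions v b) (x := fun o => o.elim 1 fun p => (T p : ℚ)) (k₀ := none)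
    (fun a => by
      have := congrArg (Nat.cast : ℕ → ℚ) (hT a)
      push_cast at this
      simpa using this)
    (by rintro (_ | p) <;> simp) one_pos
  simp only [Option.elim_none, Fintype.card_option, Nat.cast_add, Nat.cast_one] at hbig
  have hcpos : 0 < e none := by
    refine lt_of_le_of_ne (hnn none) fun h => ?_
    rw [← h, mul_zero] at hbig
    exact absurd hbig (not_le.2 one_pos)
  set c := e none with hc
  let σ : Finset P := Finset.univ.filter fun p => e (some p) ≠ 0
  have hσ : ∀ p, p ∉ σ ↔ e (some p) = 0 := fun p => by simp [σ]
  have hind : ∀ μ : P → ℚ, (∀ p ∉ σ, μ p = 0) → (∀ a, ∑ p, μ p * v p a = 0) → μ = 0 := by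
    intro μ hμ hμ0
    obtain ⟨t, ht⟩ := hmin (fun o => o.elim 0 μ) (fun a => by simpa using hμ0 a) (by
      rintro (_ | p) hp
      · rfl
      · exact hμ p ((hσ p).2 hp))
    have ht0 : t = 0 := by
      have := congrFun ht none
      simp only [Option.elim_none, Pi.smul_apply, smul_eq_mul] at this
      exact (mul_eq_zero.1 this.symm).resolve_right hcpos.ne'
    ext p
    have := congrFun ht (some p)
    simpa [ht0] using this
  have hsum : ∀ a, ∑ p, e (some p) / c * v p a = b a := fun a => by
    simp only [div_mul_eq_mul_div, ← Finset.sum_div, heU a]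
    exact mul_div_cancel_left₀ _ hcpos.ne'
  refine ⟨σ, fun p => e (some p) / c, ?_, ?_, fun p => div_nonneg (hnn _) hcpos.le,
    fun p hp => by simp [(hσ p).1 hp], hsum, fun p => ?_, fun z' hz' hz'b => ?_⟩
  · rw [Finset.nonempty_iff_ne_empty]
    intro h
    refine hb (funext fun a => ?_)
    have h1 := hsum a
    rw [Finset.sum_eq_zero fun p _ => by rw [(hσ p).1 (by simp [h])]; simp] at h1
    exact_mod_cast h1.symm
  · by_contra hcon
    obtain ⟨ν, hν0, hνσ, hν⟩ := exists_relation_of_card_lt σ (fun p a => (v p a : ℚ))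
      (by simpa using hcon)
    exact hν0 (hind ν hνσ hν)
  · rw [div_le_iff₀ hcpos]
    have h1 : e (some p) ≤ T p := hle (some p)
    have h2 : (0 : ℚ) ≤ T p := Nat.cast_nonneg _
    nlinarith
  · rw [← sub_eq_zero]
    refine hind _ (fun p hp => ?_) fun a => ?_
    · simp [hz' p hp, (hσ p).1 hp]
    · simp only [Pi.sub_apply, sub_mul, Finset.sum_sub_distrib, hz'b, hsum, sub_self]

/-- The matrix of the system `∑ p ∈ σ, z (σ, p) • v p = x` for all `σ ∈ X`. -/
def coneIntersectionMatrix {P : Type*} [DecidableEq P] {d : ℕ} (v : P → Fin d → ℕ)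
    (X : Set (Finset P)) : Matrix (X × Fin d) ((X × P) ⊕ Fin d) ℤ :=
  Matrix.of fun i => Sum.elim
    (fun q => if q.1 = i.1 then if q.2 ∈ i.1.1 then (v q.2 i.2 : ℤ) else 0 else 0)
    (fun a => if a = i.2 then -1 else 0)

/-- A row meets only the at most `d` columns of its own support and one entry `-1`, so the bound
does not depend on the number of supports. -/
theorem sum_abs_coneIntersectionMatrix_le {P : Type*} [Fintype P] [DecidableEq P] {d D : ℕ}
    {v : P → Fin d → ℕ} (hvD : ∀ p a, v p a ≤ D) {X : Set (Finset P)} [Fintype X]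
    (hX : ∀ σ ∈ X, σ.card ≤ d) (i : X × Fin d) :
    ∑ j, |coneIntersectionMatrix v X i j| ≤ ((d * D + 1 : ℕ) : ℤ) := by
  rw [Fintype.sum_sum_type, Fintype.sum_prod_type]
  simp only [coneIntersectionMatrix, Matrix.of_apply, Sum.elim_inl, Sum.elim_inr, apply_ite abs,
    abs_zero, abs_neg, abs_one, Nat.abs_cast, Finset.sum_ite_eq', Finset.mem_univ, if_true]
  rw [Finset.sum_comm]
  simp only [Finset.sum_ite_eq', Finset.mem_univ, if_true, Finset.sum_ite_mem, Finset.univ_inter]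
  push_cast
  refine (add_le_add_iff_right _).2 ?_
  calc ∑ p ∈ i.1.1, (v p i.2 : ℤ) ≤ ∑ p ∈ i.1.1, (D : ℤ) :=
        Finset.sum_le_sum fun p _ => by exact_mod_cast hvD p i.2
    _ ≤ d * D := by
        rw [Finset.sum_const, nsmul_eq_mul]
        exact mul_le_mul_of_nonneg_right (by exact_mod_cast hX _ i.1.2) (by positivity)

theorem mem_ker_coneIntersectionMatrix {P : Type*} [Fintype P] [DecidableEq P] {d : ℕ}
    {v : P → Fin d → ℕ} {X : Set (Finset P)} [Fintype X] (u : (X × P) ⊕ Fin d → ℚ) :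
    u ∈ LinearMap.ker ((coneIntersectionMatrix v X).map (Int.cast : ℤ → ℚ)).mulVecLin ↔
      ∀ (ξ : X) a, ∑ p ∈ ξ.1, u (.inl (ξ, p)) * v p a = u (.inr a) := by
  rw [LinearMap.mem_ker, funext_iff, Prod.forall]
  refine forall₂_congr fun ξ a => ?_
  rw [Matrix.mulVecLin_apply, Matrix.mulVec, dotProduct, Fintype.sum_sum_type,
    Fintype.sum_prod_type, Finset.sum_comm]
  simp only [coneIntersectionMatrix, Matrix.map_apply, Matrix.of_apply, Sum.elim_inl, Sum.elim_inr,
    Int.cast_ite, Int.cast_zero, Int.cast_natCast, Int.cast_neg, Int.cast_one, ite_mul, zero_mul,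
    neg_mul, one_mul, Finset.sum_ite_eq', Finset.mem_univ, if_true, Finset.sum_ite_mem,
    Finset.univ_inter, Pi.zero_apply, mul_comm (v _ _ : ℚ), add_neg_eq_zero]

/-- Combinations with a common value contain nonzero subcombinations with a common bounded
value. -/
theorem exists_bounded_common_subcombination {ι P : Type*} [Fintype P] {d D : ℕ}
    {v : P → Fin d → ℕ} (hvD : ∀ p a, v p a ≤ D) {b : Fin d → ℕ} (hb : b ≠ 0)
    {T : ι → P → ℕ} (hT : ∀ i a, ∑ p, T i p * v p a = b a) :
    ∃ (S : ι → P → ℕ) (b' : Fin d → ℕ), S ≤ T ∧ b' ≤ b ∧ b' ≠ 0 ∧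
      (∀ i a, ∑ p, S i p * v p a = b' a) ∧
      ∀ a, b' a ≤ (Fintype.card P + 1) * (Fintype.card P ^ d * Fintype.card P + d) *
        (d * D + 1) ^ (Fintype.card P ^ d * d) := by
  classical
  choose σ z hσ0 hσd hz0 hzσ hzb hzT hzu using fun i => exists_basic_combination hb (hT i)
  let X : Set (Finset P) := Set.range σ
  have : Fintype X := Fintype.ofFinite X
  have hXcard : Fintype.card X ≤ Fintype.card P ^ d := by
    have h : ∀ ξ : X, ∃ f : Fin d → P, Finset.univ.image f = ξ.1 := by
      rintro ⟨-, i, rfl⟩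
      exact Finset.exists_fin_image_eq _ (hσ0 i) (hσd i)
    choose F hF using h
    have hFi : Function.Injective F := fun ξ ξ' h => Subtype.ext (by rw [← hF, ← hF, h])
    simpa using Fintype.card_le_of_injective F hFi
  have hrep : ∀ ξ : X, ∃ i, σ i = ξ.1 := fun ξ => ξ.2
  choose rep hrep using hrep
  let ξ : ι → X := fun i => ⟨σ i, Set.mem_range_self i⟩
  -- Uniqueness of basic solutions: blocks with the same support share their coefficients, so `n`
  -- disappears from the system.
  have hzrep : ∀ i, z (rep (ξ i)) = z i := by
    intro i
    have h := hrep (ξ i)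
    exact hzu i _ (fun p hp => hzσ _ p (by rwa [h])) (hzb _)
  obtain ⟨a₁, ha₁⟩ := Function.ne_iff.1 hb
  have : Nonempty (Fin d) := ⟨a₁⟩
  -- At a maximal coordinate, a bound on `b a₀` bounds all of `b`.
  obtain ⟨a₀, ha₀⟩ := Finite.exists_max b
  have hba₀ : 0 < b a₀ := (Nat.pos_of_ne_zero ha₁).trans_le (ha₀ a₁)
  let x : (X × P) ⊕ Fin d → ℚ := Sum.elim (fun q => z (rep q.1) q.2) fun a => b a
  obtain ⟨e, he, hle, hbig⟩ := exists_isElementary_le (x := x) (k₀ := .inr a₀)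
    ((mem_ker_coneIntersectionMatrix (v := v) x).2 fun ξ a => by
      rw [Finset.sum_subset (Finset.subset_univ _) fun p _ hp => by
        simp only [x, Sum.elim_inl]
        rw [hzσ _ p (by rwa [hrep]), zero_mul]]
      exact hzb (rep ξ) a)
    (by
      rintro (q | a)
      · exact hz0 _ _
      · exact Nat.cast_nonneg _)
    (Nat.cast_pos.2 hba₀)
  obtain ⟨c, g, hc, heg, hg⟩ := he.exists_natural (Nat.succ_pos _)
    (sum_abs_coneIntersectionMatrix_le hvD (by rintro - ⟨i, rfl⟩; exact hσd i))
  have hker := (mem_ker_coneIntersectionMatrix e).1 he.1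
  have hg' : ∀ k, g k ≤ (d * D + 1) ^ (Fintype.card P ^ d * d) := fun k => (hg k).trans <| by
    refine Nat.pow_le_pow_right (Nat.succ_pos _) ?_
    rw [Fintype.card_prod, Fintype.card_fin]
    exact Nat.mul_le_mul_right _ hXcard
  rw [Fintype.card_sum, Fintype.card_prod, Fintype.card_fin] at hbig
  simp only [x, Sum.elim_inr, heg] at hbig
  -- For `c ≥ |P| + 1`, the integral vector satisfies `g ≤ z / c ≤ T`. Otherwise `b a₀` is at most
  -- the number of coordinates times `c * g`, and `T` itself serves.
  by_cases hcP : (Fintype.card P + 1 : ℚ) ≤ c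
  · refine ⟨fun i p => g (.inl (ξ i, p)), fun a => g (.inr a), fun i p => ?_,
      fun a => ?_, fun h => ?_, fun i a => ?_, fun a => (hg' _).trans ?_⟩
    · have h1 : c * g (.inl (ξ i, p)) ≤ z i p := by
        rw [← heg, ← hzrep]
        exact hle _
      have h2 : (Fintype.card P + 1 : ℚ) * g (.inl (ξ i, p)) ≤
          (Fintype.card P + 1) * T i p :=
        (mul_le_mul_of_nonneg_right hcP (Nat.cast_nonneg _)).trans (h1.trans (hzT i p))
      exact_mod_cast le_of_mul_le_mul_left h2 (by positivity)
    · have h1 : c * g (.inr a) ≤ b a := by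
        rw [← heg]
        exact hle _
      have h2 : (1 : ℚ) ≤ c := le_trans (le_add_of_nonneg_left (Nat.cast_nonneg _)) hcP
      have h3 : (g (.inr a) : ℚ) ≤ b a :=
        (le_mul_of_one_le_left (Nat.cast_nonneg _) h2).trans h1
      exact_mod_cast h3
    · rw [show g (.inr a₀) = 0 from congrFun h a₀] at hbig
      simp only [Nat.cast_zero, mul_zero] at hbig
      exact absurd hbig (not_le.2 (by exact_mod_cast hba₀))
    · have h1 := hker (ξ i) a
      simp only [heg, mul_assoc, ← Finset.mul_sum] at h1
      have h2 := mul_left_cancel₀ hc.ne' h1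
      rw [← Finset.sum_subset (Finset.subset_univ (σ i)) fun p _ hp => ?_]
      · exact_mod_cast h2
      · have h3 : c * g (.inl (ξ i, p)) ≤ 0 := by
          rw [← heg, ← hzσ i p hp, ← hzrep]
          exact hle _
        have h4 : (g (.inl (ξ i, p)) : ℚ) ≤ 0 := nonpos_of_mul_nonpos_right h3 hc
        have h5 : g (.inl (ξ i, p)) = 0 := Nat.le_zero.1 (by exact_mod_cast h4)
        simp only [h5, zero_mul]
    · refine Nat.le_mul_of_pos_left _ (Nat.mul_pos (Nat.succ_pos _) ?_)
      exact Nat.add_pos_right _ (Fin.pos a₁)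
  · refine ⟨T, b, le_rfl, le_rfl, hb, hT, fun a => (ha₀ a).trans ?_⟩
    push Not at hcP
    have h1 : (g (.inr a₀) : ℚ) ≤ ((d * D + 1) ^ (Fintype.card P ^ d * d) : ℕ) := by
      exact_mod_cast hg' _
    have h2 : (Fintype.card X * Fintype.card P + d : ℚ) ≤
        (Fintype.card P ^ d * Fintype.card P + d : ℕ) := by
      exact_mod_cast Nat.add_le_add_right (Nat.mul_le_mul_right _ hXcard) _
    have h3 : (b a₀ : ℚ) ≤ ((Fintype.card P ^ d * Fintype.card P + d : ℕ) : ℚ) *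
        ((Fintype.card P + 1 : ℕ) * ((d * D + 1) ^ (Fintype.card P ^ d * d) : ℕ)) := by
      refine hbig.trans ?_
      push_cast at h1 h2 ⊢
      gcongr
    rw [mul_comm (Fintype.card P + 1), mul_assoc]
    exact_mod_cast h3

/-! ### Counting short vectors and estimating the bound -/

/-- The nonzero natural vectors of dimension `d` and `1`-norm at most `D`. -/
def shortVectors (d D : ℕ) : Finset (Fin d → ℕ) :=
  (Fintype.piFinset fun _ => Finset.range (D + 1)).filter fun p => p ≠ 0 ∧ ∑ a, p a ≤ D

theorem mem_shortVectors {d D : ℕ} {p : Fin d → ℕ} :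
    p ∈ shortVectors d D ↔ p ≠ 0 ∧ ∑ a, p a ≤ D := by
  simp only [shortVectors, Finset.mem_filter, Fintype.mem_piFinset, Finset.mem_range,
    Nat.lt_succ_iff, and_iff_right_iff_imp]
  exact fun h a => (Finset.single_le_sum (fun _ _ => Nat.zero_le _) (Finset.mem_univ a)).trans h.2

theorem eq_single_of_mem_shortVectors {d D : ℕ} {p : Fin d → ℕ} (hp : p ∈ shortVectors d D)
    {a : Fin d} (ha : D ≤ p a) : p = Pi.single a D := by
  have hs := (mem_shortVectors.1 hp).2
  rw [← Finset.add_sum_erase _ _ (Finset.mem_univ a)] at hs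
  ext j
  by_cases hj : j = a
  · subst hj
    rw [Pi.single_eq_same]
    omega
  · rw [Pi.single_eq_of_ne hj]
    have := Finset.single_le_sum (f := p) (fun _ _ => Nat.zero_le _)
      (Finset.mem_erase.2 ⟨hj, Finset.mem_univ j⟩)
    omega

/-- The bound `(D+1)^d` would spoil the exponent `(2rΔ+1)^(rs²)` by an unbounded factor. Only the
vectors `D • e_a` leave the box `{0, …, D-1}^d`; they are sent to `0` and to vectors with two
entries `D - 1`, whose norm exceeds `D` as `D ≥ 3`. -/
theorem card_shortVectors_le {d D : ℕ} (hd : 1 ≤ d) (hD : 3 ≤ D) :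
    (shortVectors d D).card ≤ D ^ d := by
  classical
  have : NeZero d := ⟨by omega⟩
  let φ : (Fin d → ℕ) → Fin d → ℕ := fun p j =>
    if ∀ a, p a < D then p j else if D ≤ p 0 then 0 else if j = 0 ∨ D ≤ p j then D - 1 else 0
  have hsmall : ∀ p, (∀ a, p a < D) → φ p = p := fun p hp => funext fun j => if_pos hp
  have hbig : ∀ p ∈ shortVectors d D, (¬ ∀ a, p a < D) →
      (p = Pi.single 0 D ∧ φ p = 0) ∨
        ∃ a ≠ 0, p = Pi.single a D ∧ ∀ j, φ p j = if j = 0 ∨ j = a then D - 1 else 0 := by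
    intro p hp hbig
    obtain ⟨a, ha⟩ := not_forall.1 hbig
    have hpa := eq_single_of_mem_shortVectors hp (not_lt.1 ha)
    by_cases h0 : D ≤ p 0
    · exact .inl ⟨eq_single_of_mem_shortVectors hp h0, funext fun j => by simp [φ, hbig, h0]⟩
    · have ha0 : a ≠ 0 := fun h => h0 (h ▸ not_lt.1 ha)
      refine .inr ⟨a, ha0, hpa, fun j => ?_⟩
      have hj : D ≤ p j ↔ j = a := by
        refine ⟨fun h => ?_, fun h => h ▸ not_lt.1 ha⟩
        by_contra hne
        rw [hpa, Pi.single_eq_of_ne hne] at h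
        omega
      simp only [φ, if_neg hbig, if_neg h0, hj]
  have hmix : ∀ p ∈ shortVectors d D, ∀ q ∈ shortVectors d D, (∀ a, p a < D) →
      (¬ ∀ a, q a < D) → φ p ≠ φ q := by
    intro p hp q hq hps hqb h
    rw [hsmall p hps] at h
    obtain ⟨hp0, hpD⟩ := mem_shortVectors.1 hp
    rcases hbig q hq hqb with ⟨-, h'⟩ | ⟨a, ha, -, h'⟩
    · exact hp0 (h.trans h')
    · rw [← h] at h'
      have h1 := h' 0
      have h2 := h' a
      rw [if_pos (.inl rfl)] at h1
      rw [if_pos (.inr rfl)] at h2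
      rw [← Finset.add_sum_erase _ _ (Finset.mem_univ a)] at hpD
      have := Finset.single_le_sum (f := p) (fun _ _ => Nat.zero_le _)
        (Finset.mem_erase.2 ⟨ha.symm, Finset.mem_univ (0 : Fin d)⟩)
      omega
  have hcard : (Fintype.piFinset fun _ : Fin d => Finset.range D).card = D ^ d := by simp
  rw [← hcard]
  refine Finset.card_le_card_of_injOn φ (fun p hp => ?_) fun p hp q hq h => ?_
  · simp only [Finset.mem_coe, Fintype.mem_piFinset, Finset.mem_range]
    intro j
    simp only [φ]
    split_ifs with h1
    · exact h1 j
    all_goals omega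
  · by_cases hps : ∀ a, p a < D <;> by_cases hqs : ∀ a, q a < D
    · rwa [hsmall p hps, hsmall q hqs] at h
    · exact absurd h (hmix p hp q hq hps hqs)
    · exact absurd h.symm (hmix q hq p hp hqs hps)
    · rcases hbig p hp hps with ⟨h1, h1'⟩ | ⟨a, ha, h1, h1'⟩ <;>
        rcases hbig q hq hqs with ⟨h2, h2'⟩ | ⟨a', ha', h2, h2'⟩
      · rw [h1, h2]
      · have := h2' 0
        rw [← h, h1', if_pos (.inl rfl), Pi.zero_apply] at this
        omega
      · have := h1' 0
        rw [h, h2', if_pos (.inl rfl), Pi.zero_apply] at this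
        omega
      · have : (if a = 0 ∨ a = a' then D - 1 else 0) = D - 1 := by
          rw [← h2' a, ← h, h1', if_pos (.inr rfl)]
        have haa : a = a' := by
          by_contra hne
          rw [if_neg (by simp [ha, hne])] at this
          omega
        rw [h1, h2, haa]

theorem mul_bound_le_twoStageBound {r s Δ : ℕ} (hr : 1 ≤ r) (hs : 1 ≤ s) (hΔ : 1 ≤ Δ) :
    (2 * r * Δ + 1) ^ r * (s * ((((2 * r * Δ + 1) ^ r) ^ s + 1) *
      ((((2 * r * Δ + 1) ^ r) ^ s) ^ s * ((2 * r * Δ + 1) ^ r) ^ s + s) *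
        (s * (2 * r * Δ + 1) ^ r + 1) ^ ((((2 * r * Δ + 1) ^ r) ^ s) ^ s * s))) ≤
      twoStageBound 19 r s Δ := by
  set D := (2 * r * Δ + 1) ^ r with hD
  set Q := max 2 (r * s * Δ) with hQ
  set W := (D ^ s) ^ s with hW
  have hWeq : (2 * r * Δ + 1) ^ (r * s ^ 2) = W := by
    rw [hW, hD, ← pow_mul, ← pow_mul, sq, mul_assoc]
  have hQ2 : 2 ≤ Q := le_max_left _ _
  have hQ0 : 0 < Q := by omega
  have hD1 : 1 ≤ D := Nat.one_le_pow _ _ (by omega)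
  have hDs1 : 1 ≤ D ^ s := Nat.one_le_pow _ _ hD1
  have hW1 : 1 ≤ W := Nat.one_le_pow _ _ hDs1
  have hrs : r * s * Δ ≤ Q := le_max_right _ _
  have hsQ : s ≤ Q := by nlinarith [Nat.mul_le_mul hr hΔ, Nat.mul_le_mul_left s (Nat.mul_le_mul hr hΔ)]
  have hrQ : r * Δ ≤ Q := by nlinarith [Nat.mul_le_mul_left (r * Δ) hs]
  have hbase : 2 * r * Δ + 1 ≤ Q ^ 3 := by
    have : 2 * r * Δ + 1 ≤ 2 * Q + 1 := by rw [mul_assoc]; omega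
    have h4 : 2 * 2 * Q ≤ Q ^ 3 := by
      rw [pow_succ, sq]
      exact Nat.mul_le_mul_right _ (Nat.mul_le_mul hQ2 hQ2)
    omega
  have hDQ : D ≤ Q ^ (3 * r) := by
    rw [pow_mul]
    exact Nat.pow_le_pow_left hbase r
  have hDsQ : D ^ s ≤ Q ^ (3 * r * s) := by
    rw [pow_mul]
    exact Nat.pow_le_pow_left hDQ s
  have hWQ : W ≤ Q ^ W := (Nat.lt_pow_self (by omega)).le
  have h1 : D ^ s + 1 ≤ Q ^ (1 + 3 * r * s) := by
    rw [pow_add, pow_one]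
    nlinarith
  have h2 : W * D ^ s + s ≤ Q ^ (2 + W + 3 * r * s) := by
    have h3 : W * D ^ s + s ≤ Q * (s * (W * D ^ s)) := by
      have h4 : 1 ≤ W * D ^ s := Nat.mul_le_mul hW1 hDs1
      nlinarith [Nat.mul_le_mul_left (s * (W * D ^ s)) hQ2, Nat.mul_le_mul hs (le_refl (W * D ^ s)),
        Nat.mul_le_mul_left s h4]
    calc _ ≤ Q * (s * (W * D ^ s)) := h3
      _ ≤ Q * (Q * (Q ^ W * Q ^ (3 * r * s))) := by gcongr
      _ = _ := by ring
  have h3 : s * D + 1 ≤ Q ^ (2 + 3 * r) := by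
    have h4 : s * D + 1 ≤ Q * (s * D) := by nlinarith [Nat.mul_le_mul hs hD1]
    calc _ ≤ Q * (s * D) := h4
      _ ≤ Q * (Q * Q ^ (3 * r)) := by gcongr
      _ = _ := by ring
  rw [twoStageBound, hWeq, ← hQ]
  calc _ ≤ Q ^ (3 * r) * (Q * ((Q ^ (1 + 3 * r * s) * Q ^ (2 + W + 3 * r * s)) *
        (Q ^ (2 + 3 * r)) ^ (W * s))) := by gcongr
    _ = Q ^ (3 * r + 1 + (1 + 3 * r * s) + (2 + W + 3 * r * s) + (2 + 3 * r) * (W * s)) := by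
        rw [← pow_mul]
        ring
    _ ≤ _ := by
        -- Each summand of the exponent is at most a multiple of `r * s * W`; the coefficients add
        -- up to `19`.
        refine Nat.pow_le_pow_right hQ0 ?_
        have e1 : r ≤ r * s * W := by
          rw [mul_assoc]; exact Nat.le_mul_of_pos_right _ (Nat.mul_pos hs hW1)
        have e2 : r * s ≤ r * s * W := Nat.le_mul_of_pos_right _ hW1
        have e3 : W ≤ r * s * W := Nat.le_mul_of_pos_left _ (Nat.mul_pos hr hs)
        have e4 : W * s ≤ r * s * W := by
          rw [mul_assoc, mul_comm s]; exact Nat.le_mul_of_pos_left _ hr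
        have e5 : (2 + 3 * r) * (W * s) = 2 * (W * s) + 3 * (r * s * W) := by ring
        rw [e5, mul_assoc 3 r s]
        omega

/-! ### Minimal kernel vectors of the two-stage matrix -/

theorem twoStageMatrix_mulVec {n r s t : ℕ} (A : Fin n → Matrix (Fin r) (Fin s) ℤ)
    (B : Fin n → Matrix (Fin r) (Fin t) ℤ) (y : Fin s ⊕ Fin n × Fin t → ℤ) (i : Fin n)
    (a : Fin r) : (twoStageMatrix A B).mulVec y (i, a) =
      ∑ j, A i a j * y (.inl j) + ∑ j, B i a j * y (.inr (i, j)) := by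
  rw [Matrix.mulVec, dotProduct, Fintype.sum_sum_type, Fintype.sum_prod_type, Finset.sum_comm]
  simp [twoStageMatrix, ite_mul]

/-- The vector supported on the shared columns and one block, as a vector of all columns. -/
def blockVector {n s t : ℕ} (i : Fin n) (w : Fin s ⊕ Fin t → ℕ) : Fin s ⊕ Fin n × Fin t → ℕ :=
  Sum.elim (fun _ => 0) fun q => if q.1 = i then w (.inr q.2) else 0

/-- Minimality is used twice: against a single short summand without shared part, and against the
assembly of subsums with common shared part `b'`. -/
theorem sum_le_of_indecomposable {n r s t Δ : ℕ} (hr : 1 ≤ r) (hs : 1 ≤ s) (hΔ : 1 ≤ Δ)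
    {A : Fin n → Matrix (Fin r) (Fin s) ℤ} {B : Fin n → Matrix (Fin r) (Fin t) ℤ}
    (hA : ∀ i k j, |A i k j| ≤ (Δ : ℤ)) (hB : ∀ i k j, |B i k j| ≤ (Δ : ℤ))
    {y : Fin s ⊕ Fin n × Fin t → ℕ}
    (hy : ∀ i a, ∑ j, A i a j * y (.inl j) + ∑ j, B i a j * y (.inr (i, j)) = 0)
    (hmin : ∀ u ≤ y, (∀ i a, ∑ j, A i a j * u (.inl j) + ∑ j, B i a j * u (.inr (i, j)) = 0) →
      u ≠ 0 → u = y) :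
    ∑ j, y (.inl j) ≤ twoStageBound 19 r s Δ ∧
      ∀ i, ∑ j, y (.inr (i, j)) ≤ twoStageBound 19 r s Δ := by
  classical
  have hrΔ : 1 ≤ r * Δ := Nat.mul_le_mul hr hΔ
  have hbound := mul_bound_le_twoStageBound hr hs hΔ
  set D := (2 * r * Δ + 1) ^ r with hD
  set K := ((D ^ s + 1) * ((D ^ s) ^ s * D ^ s + s) * (s * D + 1) ^ ((D ^ s) ^ s * s)) with hK
  have hD3 : 3 ≤ D := by
    refine le_trans ?_ (Nat.le_self_pow (by omega) _)
    rw [mul_assoc]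
    omega
  have hK1 : 1 ≤ K := Nat.mul_pos (Nat.mul_pos (Nat.succ_pos _) (Nat.add_pos_right _ hs))
    (Nat.pow_pos (Nat.succ_pos _))
  have hsK : s * K ≤ twoStageBound 19 r s Δ :=
    (Nat.le_mul_of_pos_left _ (by omega)).trans hbound
  have hDb : D ≤ twoStageBound 19 r s Δ :=
    (Nat.le_mul_of_pos_right _ (Nat.mul_pos hs hK1)).trans hbound
  have hdec : ∀ i, ∃ (m : ℕ) (w : Fin m → Fin s ⊕ Fin t → ℕ),
      ∑ j, w j = Sum.elim (fun j => y (.inl j)) (fun j => y (.inr (i, j))) ∧ ∀ j, w j ≠ 0 ∧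
      (∀ a, ∑ k, Matrix.fromCols (A i) (B i) a k * w j k = 0) ∧ ∑ k, w j k ≤ D := fun i =>
    exists_kernel_decomposition (Δ := Δ) (by rintro a (k | k); exacts [hA i a k, hB i a k]) _
      (fun a => by simpa using hy i a)
  choose m w hwsum hw0 hwker hwD using hdec
  have hwl : ∀ i a, ∑ j, w i j (.inl a) = y (.inl a) := fun i a => by
    simpa using congrFun (hwsum i) (.inl a)
  have hwr : ∀ i a, ∑ j, w i j (.inr a) = y (.inr (i, a)) := fun i a => by
    simpa using congrFun (hwsum i) (.inr a)
  have hwker' : ∀ i j a, ∑ k, A i a k * w i j (.inl k) + ∑ k, B i a k * w i j (.inr k) = 0 :=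
    fun i j a => by simpa using hwker i j a
  have hsingle : ∀ i j, (∀ a, w i j (.inl a) = 0) → blockVector i (w i j) = y := by
    intro i j h0
    refine hmin _ ?_ (fun i' a => ?_) fun h => hw0 i j (funext fun k => ?_)
    · rintro (a | ⟨i', a⟩)
      · exact Nat.zero_le _
      · simp only [blockVector, Sum.elim_inr]
        split_ifs with h
        · subst h
          rw [← hwr]
          exact Finset.single_le_sum (f := fun j => w i' j (.inr a)) (fun _ _ => Nat.zero_le _)
            (Finset.mem_univ j)
        · exact Nat.zero_le _
    · simp only [blockVector, Sum.elim_inl, Sum.elim_inr]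
      by_cases h : i' = i
      · subst h
        simpa [h0] using hwker' i' j a
      · simp [h]
    · rcases k with k | k
      · exact h0 k
      · simpa [blockVector] using congrFun h (.inr (i, k))
  by_cases hb : (fun j => y (.inl j)) = 0
  · have hb' : ∀ j, y (.inl j) = 0 := fun j => congrFun hb j
    refine ⟨by simp [hb'], fun i => ?_⟩
    rcases Nat.eq_zero_or_pos (m i) with hm | hm
    · have : IsEmpty (Fin (m i)) := by rw [hm]; infer_instance
      simp [← hwr]
    · let j₀ : Fin (m i) := ⟨0, hm⟩
      have h := hsingle i j₀ fun a => by
        have := hwl i a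
        rw [hb', Finset.sum_eq_zero_iff] at this
        exact this j₀ (Finset.mem_univ _)
      refine le_trans ?_ ((hwD i j₀).trans hDb)
      rw [← h, Fintype.sum_sum_type]
      simp [blockVector]
  have hproj : ∀ i j, (fun a => w i j (.inl a)) ≠ 0 := by
    intro i j h
    refine hb (funext fun a => ?_)
    rw [← hsingle i j fun a => congrFun h a]
    rfl
  have hshort : ∀ i j, (fun a => w i j (.inl a)) ∈ shortVectors s D := by
    intro i j
    refine mem_shortVectors.2 ⟨hproj i j, le_trans ?_ (hwD i j)⟩
    rw [Fintype.sum_sum_type]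
    exact Nat.le_add_right _ _
  -- Multiplicity with which the shared part `p` occurs in the decomposition of block `i`.
  let T : Fin n → shortVectors s D → ℕ := fun i p =>
    (Finset.univ.filter fun j => (fun a => w i j (.inl a)) = p.1).card
  have hT : ∀ i a, ∑ p, T i p * p.1 a = y (.inl a) := by
    intro i a
    rw [← hwl, ← Finset.sum_fiberwise Finset.univ
      fun j => (⟨fun a => w i j (.inl a), hshort i j⟩ : shortVectors s D)]
    refine Finset.sum_congr rfl fun p _ => ?_
    rw [Finset.sum_congr rfl (g := fun _ => p.1 a) fun j hj => by
      rw [← (Finset.mem_filter.1 hj).2], Finset.sum_const, smul_eq_mul]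
    simp only [T, Subtype.ext_iff]
  obtain ⟨S, b', hST, hb'b, hb'0, hSb, hb'K⟩ := exists_bounded_common_subcombination (D := D)
    (v := fun p : shortVectors s D => p.1)
    (fun p a => (Finset.single_le_sum (fun _ _ => Nat.zero_le _) (Finset.mem_univ a)).trans
      (mem_shortVectors.1 p.2).2) hb hT
  have hPcard := card_shortVectors_le hs hD3
  have hb'K' : ∀ a, b' a ≤ K := fun a => (hb'K a).trans <| by
    rw [Fintype.card_coe, hK]
    gcongr
    exact Nat.succ_pos _
  -- The multiplicities `S` are realized by actual summands, so their diagonal parts are selected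
  -- along with them.
  choose Q hQsub hQcard using fun i p => Finset.exists_subset_card_eq (hST i p)
  have hQmem : ∀ i p, ∀ j ∈ Q i p, (fun a => w i j (.inl a)) = p.1 := fun i p j hj =>
    (Finset.mem_filter.1 (hQsub i p hj)).2
  let J : ∀ i, Finset (Fin (m i)) := fun i => Finset.univ.biUnion (Q i)
  have hJ : ∀ i a, ∑ j ∈ J i, w i j (.inl a) = b' a := by
    intro i a
    rw [← hSb, Finset.sum_biUnion]
    · refine Finset.sum_congr rfl fun p _ => ?_
      rw [Finset.sum_congr rfl (g := fun _ => p.1 a) fun j hj => congrFun (hQmem i p j hj) a,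
        Finset.sum_const, hQcard, smul_eq_mul]
    · intro p _ q _ hpq
      refine Finset.disjoint_left.2 fun j hj hj' => hpq (Subtype.ext ?_)
      rw [← hQmem i p j hj, hQmem i q j hj']
  have hu := hmin (Sum.elim b' fun q => ∑ j ∈ J q.1, w q.1 j (.inr q.2)) (by
      rintro (a | ⟨i, a⟩)
      · exact hb'b a
      · simp only [Sum.elim_inr]
        rw [← hwr]
        exact Finset.sum_le_sum_of_subset (Finset.subset_univ _))
    (fun i a => by
      simp only [Sum.elim_inl, Sum.elim_inr, ← hJ i]
      push_cast
      simp only [Finset.mul_sum]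
      rw [Finset.sum_comm, Finset.sum_comm (s := Finset.univ (α := Fin t)),
        ← Finset.sum_add_distrib]
      exact Finset.sum_eq_zero fun j _ => hwker' i j a)
    (fun h => hb'0 (funext fun a => congrFun h (.inl a)))
  have hyb : ∀ a, y (.inl a) = b' a := fun a => by rw [← hu]; rfl
  have hysum : ∑ j, y (.inl j) ≤ s * K := by
    calc ∑ j, y (.inl j) ≤ ∑ _j : Fin s, K := Finset.sum_le_sum fun a _ => (hyb a).trans_le (hb'K' a)
      _ = s * K := by simp
  refine ⟨hysum.trans hsK, fun i => le_trans ?_ hbound⟩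
  -- Each summand has a nonzero shared part and so contributes at least `1` to the norm of `y⁰`.
  have hm : m i ≤ s * K := by
    calc m i = ∑ _j : Fin (m i), 1 := by simp
      _ ≤ ∑ j, ∑ a, w i j (.inl a) := Finset.sum_le_sum fun j _ => by
          obtain ⟨a, ha⟩ := Function.ne_iff.1 (hproj i j)
          exact (Nat.one_le_iff_ne_zero.2 ha).trans (Finset.single_le_sum
            (f := fun a => w i j (.inl a)) (fun _ _ => Nat.zero_le _) (Finset.mem_univ a))
      _ = ∑ a, y (.inl a) := by
          rw [Finset.sum_comm]
          exact Finset.sum_congr rfl fun a _ => hwl i a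
      _ ≤ s * K := hysum
  calc ∑ a, y (.inr (i, a)) = ∑ j, ∑ a, w i j (.inr a) := by
        rw [Finset.sum_comm]
        exact Finset.sum_congr rfl fun a _ => (hwr i a).symm
    _ ≤ ∑ _j : Fin (m i), D := Finset.sum_le_sum fun j _ => by
        refine le_trans ?_ (hwD i j)
        rw [Fintype.sum_sum_type]
        exact Nat.le_add_left _ _
    _ = D * m i := by simp [mul_comm]
    _ ≤ D * (s * K) := Nat.mul_le_mul_left _ hm

/-! ### Sign reduction and the main theorem -/

theorem sum_le_one_of_forall_le_eq {κ : Type*} [Fintype κ] {y : κ → ℕ}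
    (h : ∀ u ≤ y, u ≠ 0 → u = y) : ∑ k, y k ≤ 1 := by
  classical
  by_cases hy : y = 0
  · simp [hy]
  obtain ⟨k, hk⟩ := Function.ne_iff.1 hy
  have := h (Pi.single k 1) (fun j => by
    by_cases hj : j = k
    · subst hj
      rw [Pi.single_eq_same]
      exact Nat.one_le_iff_ne_zero.2 hk
    · rw [Pi.single_eq_of_ne hj]
      exact Nat.zero_le _) (fun h => absurd (congrFun h k) (by simp))
  rw [← this]
  simp

/-- After flipping the signs of the columns, a Graver element becomes a natural vector that is
minimal in the kernel. -/
theorem IsGraverElement.eq_of_le_natAbs {m k : Type*} [Fintype k] {M : Matrix m k ℤ} {y : k → ℤ}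
    (hy : IsGraverElement M y) {u : k → ℕ} (hu : ∀ j, u j ≤ (y j).natAbs) (hu0 : u ≠ 0)
    (hMu : M.mulVec (fun j => (if y j < 0 then -1 else 1) * (u j : ℤ)) = 0) :
    u = fun j => (y j).natAbs := by
  by_contra hne
  -- Giving `u` the signs of `y` makes `U` and `y - U` sign-compatible, because `u ≤ |y|`.
  set U : k → ℤ := fun j => (if y j < 0 then -1 else 1) * (u j : ℤ) with hU
  refine hy.2 ⟨U, y - U, hMu, by rw [Matrix.mulVec_sub, hy.1, hMu, sub_zero], fun h => ?_,
    fun h => ?_, by simp, fun j => ?_⟩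
  · refine hu0 (funext fun j => ?_)
    have := congrFun h j
    simp only [hU, Pi.zero_apply] at this
    split_ifs at this
    · simpa using this
    · simpa using this
  · refine hne (funext fun j => ?_)
    have := congrFun h j
    simp only [hU, Pi.zero_apply, Pi.sub_apply] at this
    split_ifs at this <;> omega
  · have := hu j
    simp only [hU, Pi.sub_apply]
    split_ifs with h
    · have h1 : (u j : ℤ) ≤ -y j := by omega
      nlinarith [Int.natCast_nonneg (u j)]
    · have h1 : (u j : ℤ) ≤ y j := by omega
      nlinarith [Int.natCast_nonneg (u j)]

theorem mainTheorem2 :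
    ∃ C : ℕ, ∀ (n r s t Δ : ℕ), 1 ≤ s →
      ∀ (A : Fin n → Matrix (Fin r) (Fin s) ℤ) (B : Fin n → Matrix (Fin r) (Fin t) ℤ),
        (∀ i k j, |A i k j| ≤ (Δ : ℤ)) → (∀ i k j, |B i k j| ≤ (Δ : ℤ)) →
        ∀ y : Fin s ⊕ Fin n × Fin t → ℤ, IsGraverElement (twoStageMatrix A B) y →
          oneNorm (verticalPart y) ≤ twoStageBound C r s Δ ∧
          (∀ i : Fin n, oneNorm (diagonalPart y i) ≤ twoStageBound C r s Δ) ∧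
          ‖y‖ ≤ (twoStageBound C r s Δ : ℝ) := by
  refine ⟨19, fun n r s t Δ hs A B hA hB y hy => ?_⟩
  suffices H : oneNorm (verticalPart y) ≤ twoStageBound 19 r s Δ ∧
      ∀ i : Fin n, oneNorm (diagonalPart y i) ≤ twoStageBound 19 r s Δ by
    refine ⟨H.1, H.2, (pi_norm_le_iff_of_nonneg (Nat.cast_nonneg _)).2 ?_⟩
    have h : ∀ k, (y k).natAbs ≤ twoStageBound 19 r s Δ := by
      rintro (j | ⟨i, j⟩)
      · exact (Finset.single_le_sum (f := fun j => (verticalPart y j).natAbs)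
          (fun _ _ => Nat.zero_le _) (Finset.mem_univ j)).trans H.1
      · exact (Finset.single_le_sum (f := fun j => (diagonalPart y i j).natAbs)
          (fun _ _ => Nat.zero_le _) (Finset.mem_univ j)).trans (H.2 i)
    intro k
    rw [Int.norm_eq_abs, ← Int.cast_abs, Int.abs_eq_natAbs, Int.cast_natCast]
    exact_mod_cast h k
  let ε : Fin s ⊕ Fin n × Fin t → ℤ := fun k => if y k < 0 then -1 else 1
  have hε : ∀ k, |ε k| = 1 := fun k => by
    simp only [ε]
    split_ifs <;> rfl
  have hεy : ∀ k, ε k * ((y k).natAbs : ℤ) = y k := fun k => by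
    simp only [ε]
    split_ifs <;> omega
  -- Here the matrix is zero or has no rows, so a Graver element has norm at most `1`; the general
  -- estimate needs `r * Δ ≥ 1`.
  by_cases h0 : r = 0 ∨ Δ = 0
  · have hM : ∀ u, (twoStageMatrix A B).mulVec u = 0 := by
      intro u
      ext ⟨i, a⟩
      rcases h0 with rfl | rfl
      · exact a.elim0
      · have hA0 : ∀ j, A i a j = 0 := fun j => abs_nonpos_iff.1 (by simpa using hA i a j)
        have hB0 : ∀ j, B i a j = 0 := fun j => abs_nonpos_iff.1 (by simpa using hB i a j)
        simp [twoStageMatrix_mulVec, hA0, hB0]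
    have h1 := sum_le_one_of_forall_le_eq (y := fun k => (y k).natAbs)
      fun u hu hu0 => hy.eq_of_le_natAbs hu hu0 (hM _)
    have h2 : 1 ≤ twoStageBound 19 r s Δ :=
      Nat.one_le_pow _ _ (lt_of_lt_of_le two_pos (le_max_left _ _))
    rw [Fintype.sum_sum_type, Fintype.sum_prod_type] at h1
    refine ⟨le_trans ?_ (h1.trans h2), fun i => le_trans ?_ (h1.trans h2)⟩
    · exact Nat.le_add_right _ _
    · exact (Finset.single_le_sum (f := fun i => ∑ j, (y (.inr (i, j))).natAbs)
        (fun _ _ => Nat.zero_le _) (Finset.mem_univ i)).trans (Nat.le_add_left _ _)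
  · push Not at h0
    have hflip : ∀ (u : Fin s ⊕ Fin n × Fin t → ℕ) i a,
        ∑ j, A i a j * ε (.inl j) * u (.inl j) + ∑ j, B i a j * ε (.inr (i, j)) * u (.inr (i, j)) =
          (twoStageMatrix A B).mulVec (fun k => ε k * (u k : ℤ)) (i, a) := fun u i a => by
      simp only [twoStageMatrix_mulVec, mul_assoc]
    -- The signs of `y` are absorbed into the columns, which preserves the bound `Δ` on the entries.
    exact sum_le_of_indecomposable (Nat.one_le_iff_ne_zero.2 h0.1) hs
      (Nat.one_le_iff_ne_zero.2 h0.2)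
      (A := fun i => Matrix.of fun a j => A i a j * ε (.inl j))
      (B := fun i => Matrix.of fun a j => B i a j * ε (.inr (i, j)))
      (y := fun k => (y k).natAbs)
      (fun i a j => by simpa [abs_mul, hε] using hA i a j)
      (fun i a j => by simpa [abs_mul, hε] using hB i a j)
      (fun i a => (hflip (fun k => (y k).natAbs) i a).trans (by
        simp only [hεy, hy.1, Pi.zero_apply]))
      (fun u hu hker hu0 => hy.eq_of_le_natAbs hu hu0 (by
        ext ⟨i, a⟩
        exact (hflip u i a).symm.trans (hker i a)))
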